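/- Let $\mathbb G=(\mathbb R^n,\star)$ be a stratified Lie group with identity $0$: $\star$ is a Lie group law on $\mathbb R^n$; there are integers $1\le\sigma_1\le\dots\le\sigma_n$ such that for every $\lambda>0$ the dilation $\delta_\lambda(x_1,\dots,x_n)=(\lambda^{\sigma_1}x_1,\dots,\lambda^{\sigma_n}x_n)$ is a group automorphism; and the first stratum, i.e. the space of left-invariant vector fields whose value at $0$ lies in the span of the coordinate directions with $\sigma_i=1$, generates the Lie algebra of $\mathbb G$. Let $X_1,\dots,X_m$ be a basis of the first stratum, $\Delta_{\mathbb G}=\sum_{k=1}^m X_k^2$ the sub-Laplacian, and $Q=\sum_{i=1}^n\sigma_i$ the homogeneous dimension. Let $p>1$ and let $u_0,f\in L^1_{loc}(\mathbb G)$ be real-valued with $u_0\ge0$ almost everywhere and $\int_{\mathbb G}f\,dx>0$, meaning that $\int f^-\,dx<\int f^+\,dx\le\infty$ (so $f$ is either integrable with positive integral or has integral $+\infty$; every non-negative $f\in L^1_{loc}(\mathbb G)$ that is not almost everywhere $0$ qualifies). Consider $$u_t-\Delta_{\mathbb G}u=|u|^p+f(x)\ \text{ on }(0,\infty)\times\mathbb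 G,\qquad u(0,\cdot)=u_0. \tag{1}$$ A global in time weak solution of (1) is a function $u\in L^p_{loc}((0,\infty)\times\mathbb G)$ such that for every test function $\psi\ge0$ on $[0,\infty)\times\mathbb G$, of class $C^1$ in time with values in $C^2_c(\mathbb G)$ and with compact support in $[0,\infty)\times\mathbb G$ ($\psi(0,\cdot)$ need not vanish), the integrals below converge absolutely and $$\int_0^\infty\!\!\int_{\mathbb G}|u|^p\psi+\int_{\mathbb G}u_0\,\psi(0,x)+\int_0^\infty\!\!\int_{\mathbb G}f\psi+\int_0^\infty\!\!\int_{\mathbb G}u\,\psi_t+\int_0^\infty\!\!\int_{\mathbb G}u\,\Delta_{\mathbb G}\psi=0 .$$ Then: 1. if $Q\ge3$ and $1<p<\frac{Q}{Q-2}$, problem (1) has no global in time weak solution; 2. if $Q\in\{1,2\}$, problem (1) has no global in time weak solution, for any $p>1$. -/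

import Mathlib

open MeasureTheory Set
open scoped ContDiff

/-- A Lie group structure on `ℝⁿ` with identity `0`, together with positive integer weights
`σ₁ ≤ ⋯ ≤ σₙ` for which the dilations `(x₁, …, xₙ) ↦ (c ^ σ₁ x₁, …, c ^ σₙ xₙ)`, `c > 0`, are
group automorphisms. -/
structure DilationGroup (n : ℕ) where
  mul : (Fin n → ℝ) → (Fin n → ℝ) → (Fin n → ℝ)
  inv : (Fin n → ℝ) → (Fin n → ℝ)
  mul_assoc : ∀ x y z, mul (mul x y) z = mul x (mul y z)
  zero_mul : ∀ x, mul 0 x = x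
  mul_zero : ∀ x, mul x 0 = x
  inv_mul : ∀ x, mul (inv x) x = 0
  mul_inv : ∀ x, mul x (inv x) = 0
  contDiff_mul : ContDiff ℝ ∞ (fun z : (Fin n → ℝ) × (Fin n → ℝ) => mul z.1 z.2)
  contDiff_inv : ContDiff ℝ ∞ inv
  weight : Fin n → ℕ
  one_le_weight : ∀ i, 1 ≤ weight i
  weight_mono : Monotone weight
  dilation_mul : ∀ c : ℝ, 0 < c → ∀ x y,
    (fun i => c ^ weight i * mul x y i) =
      mul (fun i => c ^ weight i * x i) (fun i => c ^ weight i * y i)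

namespace DilationGroup

variable {n : ℕ}

/-- The left-invariant vector field with value `v` at the origin: at `x` it is the derivative at
the origin, in direction `v`, of the left translation `y ↦ x ⋆ y`. -/
noncomputable def leftInvariantField (G : DilationGroup n) (v : Fin n → ℝ) :
    (Fin n → ℝ) → (Fin n → ℝ) :=
  fun x => fderiv ℝ (fun y => G.mul x y) 0 v

/-- The first stratum, seen in the tangent space at the origin: the span of the coordinate
directions of weight one. -/
def firstStratum (G : DilationGroup n) : Submodule ℝ (Fin n → ℝ) where
  carrier := {v | ∀ i, G.weight i ≠ 1 → v i = 0}
  add_mem' := by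
    intro v w hv hw i hi
    simp [hv i hi, hw i hi]
  zero_mem' := by
    intro i _
    rfl
  smul_mem' := by
    intro c v hv i hi
    simp [hv i hi]

/-- The homogeneous dimension `Q = σ₁ + ⋯ + σₙ`. -/
def homDim (G : DilationGroup n) : ℕ := ∑ i, G.weight i

/-- The iterated commutators (of any length, including length one) of the left-invariant vector
fields that belong to the first stratum. -/
inductive IsIteratedCommutator (G : DilationGroup n) : ((Fin n → ℝ) → (Fin n → ℝ)) → Prop
  | basic (v : Fin n → ℝ) (hv : v ∈ G.firstStratum) :
      IsIteratedCommutator G (G.leftInvariantField v)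
  | bracket (V W : (Fin n → ℝ) → (Fin n → ℝ)) (hV : IsIteratedCommutator G V)
      (hW : IsIteratedCommutator G W) : IsIteratedCommutator G (VectorField.lieBracket ℝ V W)

end DilationGroup

/-- A stratified Lie group `(ℝⁿ, ⋆)`: the first stratum generates the Lie algebra, that is, the
vector fields in it, together with their iterated commutators, span `ℝⁿ` at every point. -/
structure StratifiedGroup (n : ℕ) extends DilationGroup n where
  generates : ∀ x : Fin n → ℝ,
    Submodule.span ℝ {w | ∃ V, toDilationGroup.IsIteratedCommutator V ∧ w = V x} = ⊤

/-- The derivative `X φ` of the function `φ` along the vector field `X`. -/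
noncomputable def alongField {n : ℕ} (X : (Fin n → ℝ) → (Fin n → ℝ)) (φ : (Fin n → ℝ) → ℝ) :
    (Fin n → ℝ) → ℝ :=
  fun x => fderiv ℝ φ x (X x)

namespace StratifiedGroup

variable {n m : ℕ}

/-- The sub-Laplacian `∑ X_k²` of the left-invariant vector fields `X_1, …, X_m` given by a basis
of the first stratum. -/
noncomputable def subLaplacian (G : StratifiedGroup n)
    (b : Module.Basis (Fin m) ℝ G.firstStratum) (φ : (Fin n → ℝ) → ℝ) : (Fin n → ℝ) → ℝ :=
  fun x => ∑ k, alongField (G.leftInvariantField (b k : Fin n → ℝ))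
    (alongField (G.leftInvariantField (b k : Fin n → ℝ)) φ) x

end StratifiedGroup

/-- Non-negative test functions for the global Cauchy problem: the restrictions to `[0, ∞) × ℝⁿ`
of functions of class `C¹` in time with values in `C²_c(ℝⁿ)`, with compact support in
`ℝ × ℝⁿ` (so they vanish for large times) and non-negative for `t ≥ 0`. They need not vanish at
`t = 0`. -/
structure IsTestFunction {n : ℕ} (ψ : ℝ → (Fin n → ℝ) → ℝ) : Prop where
  nonneg : ∀ t x, 0 ≤ t → 0 ≤ ψ t x
  compact_support : HasCompactSupport (fun z : ℝ × (Fin n → ℝ) => ψ z.1 z.2)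
  contDiff_space : ∀ t, ContDiff ℝ 2 (ψ t)
  continuous_space : ∀ j : ℕ, j ≤ 2 →
    Continuous (fun z : ℝ × (Fin n → ℝ) => iteratedFDeriv ℝ j (ψ z.1) z.2)
  differentiable_time : ∀ x, Differentiable ℝ (fun t => ψ t x)
  contDiff_space_deriv : ∀ t, ContDiff ℝ 2 (fun x => deriv (fun s => ψ s x) t)
  continuous_space_deriv : ∀ j : ℕ, j ≤ 2 → Continuous (fun z : ℝ × (Fin n → ℝ) =>
    iteratedFDeriv ℝ j (fun x => deriv (fun s => ψ s x) z.1) z.2)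

/-- `u` is a global in time weak solution of `u_t - Δ_G u = |u|^p + f` on `(0, ∞) × G`,
`u(0, ·) = u₀`. Here `u ∈ L^p_loc((0, ∞) × G)`, and the integrals in the weak formulation that
involve `u` are required to converge absolutely; the ones with `u₀` and `f` do so for locally
integrable `u₀` and `f`. -/
structure IsGlobalWeakSolution {n m : ℕ} (G : StratifiedGroup n)
    (b : Module.Basis (Fin m) ℝ G.firstStratum) (p : ℝ) (u₀ f : (Fin n → ℝ) → ℝ)
    (u : ℝ → (Fin n → ℝ) → ℝ) : Prop where
  memLp_loc : ∀ K : Set (ℝ × (Fin n → ℝ)), IsCompact K → K ⊆ Ioi 0 ×ˢ univ →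
    MemLp (fun z : ℝ × (Fin n → ℝ) => u z.1 z.2) (ENNReal.ofReal p) (volume.restrict K)
  integrable_pow : ∀ ψ, IsTestFunction ψ →
    IntegrableOn (fun z : ℝ × (Fin n → ℝ) => |u z.1 z.2| ^ p * ψ z.1 z.2) (Ioi 0 ×ˢ univ)
  integrable_time : ∀ ψ, IsTestFunction ψ →
    IntegrableOn (fun z : ℝ × (Fin n → ℝ) => u z.1 z.2 * deriv (fun s => ψ s z.2) z.1)
      (Ioi 0 ×ˢ univ)
  integrable_space : ∀ ψ, IsTestFunction ψ →
    IntegrableOn (fun z : ℝ × (Fin n → ℝ) => u z.1 z.2 * G.subLaplacian b (ψ z.1) z.2)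
      (Ioi 0 ×ˢ univ)
  weak_form : ∀ ψ, IsTestFunction ψ →
    (∫ z in Ioi (0 : ℝ) ×ˢ (univ : Set (Fin n → ℝ)), |u z.1 z.2| ^ p * ψ z.1 z.2)
      + (∫ x, u₀ x * ψ 0 x)
      + (∫ z in Ioi (0 : ℝ) ×ˢ (univ : Set (Fin n → ℝ)), f z.2 * ψ z.1 z.2)
      + (∫ z in Ioi (0 : ℝ) ×ˢ (univ : Set (Fin n → ℝ)),
          u z.1 z.2 * deriv (fun s => ψ s z.2) z.1)
      + (∫ z in Ioi (0 : ℝ) ×ˢ (univ : Set (Fin n → ℝ)),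
          u z.1 z.2 * G.subLaplacian b (ψ z.1) z.2) = 0

/-!
The proof is the test function method. Suppose that `u` is a global weak solution, and let `q` be
the exponent conjugate to `p`. The equation is tested with
`ψ (t, x) = A (t / R²) B (δ_{1/R} x)`, where `A` and `B` are smooth cutoffs equal to `1` at the
origin. They are high powers of bump functions, so that `|A'| ≤ K A ^ (1 / p)` and
`|Δ B| ≤ K B ^ (1 / p)` (`exists_time_cutoff`, `StratifiedGroup.exists_space_cutoff`). Vector fields
of the first stratum are homogeneous of degree one under dilations, so the sub-Laplacian is
homogeneous of degree two (`StratifiedGroup.subLaplacian_comp_dilation`), and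
`|ψ_t + Δ ψ| ≤ C R⁻² ψ ^ (1 / p)`. Young's inequality then absorbs `u (ψ_t + Δ ψ)` into
`|u| ^ p ψ` at the price of `(C R⁻²) ^ q` on the support of `ψ`, whose volume is at most a constant
times `R ^ (Q + 2)`; as `u₀ ≥ 0`, what remains is
`∫∫ f ψ ≤ C' R ^ (Q + 2 - 2 q)` (`IsGlobalWeakSolution.integral_mul_integral_le`).

On the other hand `∫ f > 0` and Fatou's lemma give `∫∫ f ψ ≥ ε R²` for large `R`
(`exists_pos_eventually_le_integral_mul`). Letting `R → ∞` is contradictory when `Q < 2 q`, which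
is `p < Q / (Q - 2)` if `Q ≥ 3`, and holds for every `p > 1` if `Q ≤ 2`.
-/

open Filter Topology

/-! ### Dilations and left-invariant fields -/

namespace DilationGroup

variable {n : ℕ}

/-- The dilation `δ_c`, as a continuous linear map. -/
noncomputable def dilation (G : DilationGroup n) (c : ℝ) : (Fin n → ℝ) →L[ℝ] (Fin n → ℝ) :=
  ContinuousLinearMap.pi fun i => (c ^ G.weight i) • ContinuousLinearMap.proj i

@[simp]
lemma dilation_apply (G : DilationGroup n) (c : ℝ) (x : Fin n → ℝ) (i : Fin n) :
    G.dilation c x i = c ^ G.weight i * x i := by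
  simp [dilation]

lemma dilation_mul_eq (G : DilationGroup n) {c : ℝ} (hc : 0 < c) (x y : Fin n → ℝ) :
    G.dilation c (G.mul x y) = G.mul (G.dilation c x) (G.dilation c y) := by
  have h := G.dilation_mul c hc x y
  have e : ∀ z : Fin n → ℝ, G.dilation c z = fun i => c ^ G.weight i * z i := fun z => by
    ext i; simp
  rw [e, e, e, h]

lemma dilation_of_mem_firstStratum (G : DilationGroup n) (c : ℝ) {v : Fin n → ℝ}
    (hv : v ∈ G.firstStratum) : G.dilation c v = c • v := by
  ext i
  by_cases h : G.weight i = 1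
  · simp [h]
  · simp [hv i h]

lemma contDiff_mul_left (G : DilationGroup n) (x : Fin n → ℝ) :
    ContDiff ℝ ∞ (fun y => G.mul x y) :=
  G.contDiff_mul.comp (contDiff_const.prodMk contDiff_id)

lemma contDiff_leftInvariantField (G : DilationGroup n) (v : Fin n → ℝ) :
    ContDiff ℝ ∞ (G.leftInvariantField v) := by
  have h : ContDiff ℝ ∞ (fun x => fderiv ℝ (fun y => G.mul x y) 0) :=
    ContDiff.fderiv (m := ∞) (n := ∞) (f := fun x y => G.mul x y) (g := fun _ => 0)
      G.contDiff_mul contDiff_const (by simp)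
  exact h.clm_apply contDiff_const

/-- Left-invariant fields of the first stratum are homogeneous of degree one: differentiate
`δ_c (x ⋆ y) = δ_c x ⋆ δ_c y` in `y` at the origin. -/
lemma dilation_leftInvariantField (G : DilationGroup n) {c : ℝ} (hc : 0 < c) {v : Fin n → ℝ}
    (hv : v ∈ G.firstStratum) (x : Fin n → ℝ) :
    G.dilation c (G.leftInvariantField v x) = c • G.leftInvariantField v (G.dilation c x) := by
  have hd : ∀ x, DifferentiableAt ℝ (fun y => G.mul x y) 0 := fun x =>
    (G.contDiff_mul_left x).contDiffAt.differentiableAt (by simp)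
  have h1 : HasFDerivAt (fun y => G.dilation c (G.mul x y))
      ((G.dilation c).comp (fderiv ℝ (fun y => G.mul x y) 0)) 0 :=
    (G.dilation c).hasFDerivAt.comp 0 (hd x).hasFDerivAt
  have h2 : HasFDerivAt (fun y => G.mul (G.dilation c x) (G.dilation c y))
      ((fderiv ℝ (fun y => G.mul (G.dilation c x) y) 0).comp (G.dilation c)) 0 := by
    have h0 : HasFDerivAt (fun y => G.mul (G.dilation c x) y)
        (fderiv ℝ (fun y => G.mul (G.dilation c x) y) 0) (G.dilation c 0) := by
      rw [map_zero]; exact (hd _).hasFDerivAt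
    exact h0.comp 0 (G.dilation c).hasFDerivAt
  have h3 : (fun y => G.dilation c (G.mul x y)) =
      fun y => G.mul (G.dilation c x) (G.dilation c y) := funext (G.dilation_mul_eq hc x)
  rw [h3] at h1
  have h4 := congrArg (fun T => T v) (h1.unique h2)
  simpa [leftInvariantField, G.dilation_of_mem_firstStratum c hv] using h4

lemma alongField_comp_dilation (G : DilationGroup n) {c : ℝ} (hc : 0 < c) {v : Fin n → ℝ}
    (hv : v ∈ G.firstStratum) {φ : (Fin n → ℝ) → ℝ} (hφ : Differentiable ℝ φ)
    (x : Fin n → ℝ) :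
    alongField (G.leftInvariantField v) (fun y => φ (G.dilation c y)) x =
      c * alongField (G.leftInvariantField v) φ (G.dilation c x) := by
  have h : HasFDerivAt (fun y => φ (G.dilation c y))
      ((fderiv ℝ φ (G.dilation c x)).comp (G.dilation c)) x :=
    (hφ _).hasFDerivAt.comp x (G.dilation c).hasFDerivAt
  simp [alongField, h.fderiv, G.dilation_leftInvariantField hc hv]

end DilationGroup

/-! ### Derivatives along a vector field -/

section alongField

variable {n : ℕ} {X : (Fin n → ℝ) → (Fin n → ℝ)} {φ : (Fin n → ℝ) → ℝ}

lemma ContDiff.alongField (hX : ContDiff ℝ ∞ X) (hφ : ContDiff ℝ ∞ φ) :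
    ContDiff ℝ ∞ (alongField X φ) :=
  (hφ.fderiv_right (m := ∞) (by simp)).clm_apply hX

lemma HasCompactSupport.alongField (hφ : HasCompactSupport φ) :
    HasCompactSupport (alongField X φ) :=
  (hφ.fderiv (𝕜 := ℝ)).mono fun x hx => by
    contrapose! hx
    simp only [Function.mem_support, ne_eq, not_not] at hx
    simp [_root_.alongField, hx]

lemma alongField_const_mul (hφ : Differentiable ℝ φ) (a : ℝ) :
    alongField X (fun y => a * φ y) = fun x => a * alongField X φ x := by
  ext x
  simp [alongField, fderiv_const_mul (hφ x) a]

lemma alongField_mul {χ : (Fin n → ℝ) → ℝ} (hφ : Differentiable ℝ φ) (hχ : Differentiable ℝ χ) :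
    alongField X (fun y => φ y * χ y) =
      fun x => φ x * alongField X χ x + χ x * alongField X φ x := by
  ext x
  simp [alongField, fderiv_fun_mul (hφ x) (hχ x)]

lemma alongField_pow (hφ : Differentiable ℝ φ) (k : ℕ) :
    alongField X (fun y => φ y ^ (k + 1)) =
      fun x => (k + 1) * φ x ^ k * alongField X φ x := by
  ext x
  simp [alongField, fderiv_fun_pow (k + 1) (hφ x), mul_assoc]

lemma alongField_alongField_pow (hX : ContDiff ℝ ∞ X) (hφ : ContDiff ℝ ∞ φ) (k : ℕ)
    (x : Fin n → ℝ) :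
    alongField X (alongField X (fun y => φ y ^ (k + 2))) x =
      φ x ^ k * ((k + 2) * (k + 1) * alongField X φ x ^ 2 +
        (k + 2) * φ x * alongField X (alongField X φ) x) := by
  have hd : Differentiable ℝ φ := hφ.differentiable (by simp)
  have hd' : Differentiable ℝ (alongField X φ) := (hX.alongField hφ).differentiable (by simp)
  rw [alongField_pow hd (k + 1), 
    alongField_mul (φ := fun x => (((k + 1 : ℕ) : ℝ) + 1) * φ x ^ (k + 1))
      ((hd.fun_pow _).const_mul _) hd', alongField_const_mul (hd.fun_pow _), alongField_pow hd k]
  push_cast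
  ring

end alongField

/-! ### The sub-Laplacian -/

namespace StratifiedGroup

variable {n m : ℕ} (G : StratifiedGroup n) (b : Module.Basis (Fin m) ℝ G.firstStratum)

lemma subLaplacian_const_mul {φ : (Fin n → ℝ) → ℝ} (hφ : ContDiff ℝ ∞ φ) (a : ℝ)
    (x : Fin n → ℝ) :
    G.subLaplacian b (fun y => a * φ y) x = a * G.subLaplacian b φ x := by
  simp only [subLaplacian, Finset.mul_sum]
  refine Finset.sum_congr rfl fun k _ => ?_
  rw [alongField_const_mul (hφ.differentiable (by simp)), alongField_const_mul
    (((G.contDiff_leftInvariantField _).alongField hφ).differentiable (by simp))]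

/-- The sub-Laplacian is homogeneous of degree two. -/
lemma subLaplacian_comp_dilation {c : ℝ} (hc : 0 < c) {φ : (Fin n → ℝ) → ℝ}
    (hφ : ContDiff ℝ ∞ φ) (x : Fin n → ℝ) :
    G.subLaplacian b (fun y => φ (G.dilation c y)) x =
      c ^ 2 * G.subLaplacian b φ (G.dilation c x) := by
  simp only [subLaplacian, Finset.mul_sum]
  refine Finset.sum_congr rfl fun k _ => ?_
  have hX := G.contDiff_leftInvariantField (b k : Fin n → ℝ)
  have hd := (hX.alongField hφ).differentiable (by simp)
  have h1 : alongField (G.leftInvariantField (b k : Fin n → ℝ)) (fun y => φ (G.dilation c y)) =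
      fun y => c * alongField (G.leftInvariantField (b k : Fin n → ℝ)) φ (G.dilation c y) :=
    funext (G.alongField_comp_dilation hc (b k).2 (hφ.differentiable (by simp)))
  rw [h1, alongField_const_mul
    (φ := fun y => alongField (G.leftInvariantField (b k : Fin n → ℝ)) φ (G.dilation c y))
    (hd.comp (G.dilation c).differentiable)]
  simp only [G.alongField_comp_dilation hc (b k).2 hd]
  ring

end StratifiedGroup

/-! ### Cutoff functions -/

/-- If `0 ≤ y ≤ 1` and `k + 2` is large compared with the conjugate exponent of `p`, then
`y ^ k` is controlled by the power `1 / p` of `y ^ (k + 2)`. -/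
lemma pow_le_rpow_inv_pow_add_two {p y : ℝ} (hp : 1 < p) {k : ℕ} (hk : (k + 2 : ℝ) ≤ k * p)
    (hy : 0 ≤ y) (hy1 : y ≤ 1) : y ^ k ≤ (y ^ (k + 2)) ^ p⁻¹ := by
  rw [← Real.rpow_natCast y (k + 2), ← Real.rpow_mul hy, ← Real.rpow_natCast y k]
  have hp0 : 0 < p := by linarith
  refine Real.rpow_le_rpow_of_exponent_ge' hy hy1 (by positivity) ?_
  push_cast
  rw [← div_eq_mul_inv, div_le_iff₀ hp0]
  exact hk

lemma exists_nat_add_two_le_mul {p : ℝ} (hp : 1 < p) : ∃ k : ℕ, (k + 2 : ℝ) ≤ k * p := by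
  obtain ⟨k, hk⟩ := exists_nat_ge (2 / (p - 1))
  refine ⟨k, ?_⟩
  rw [div_le_iff₀ (by linarith)] at hk
  linarith

/-- A time cutoff whose derivative is controlled by its power `1 / p`: a high power of a bump
function. -/
lemma exists_time_cutoff {p : ℝ} (hp : 1 < p) :
    ∃ (A : ℝ → ℝ) (K : ℝ), ContDiff ℝ ∞ A ∧ 0 ≤ K ∧ (∀ t, 0 ≤ A t) ∧ (∀ t, A t ≤ 1) ∧
      (∀ t ∈ Icc (-1 : ℝ) 1, A t = 1) ∧ (∀ t, t ∉ Icc (-2 : ℝ) 2 → A t = 0) ∧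
      (∀ t, |deriv A t| ≤ K * A t ^ p⁻¹) := by
  obtain ⟨k, hk⟩ := exists_nat_add_two_le_mul hp
  let a : ContDiffBump (0 : ℝ) := ⟨1, 2, one_pos, one_lt_two⟩
  have ha : ContDiff ℝ ∞ a := a.contDiff
  have hc : Continuous (deriv a) := ha.continuous_deriv (by simp)
  obtain ⟨M, hM⟩ := hc.bounded_above_of_compact_support a.hasCompactSupport.deriv
  have hM0 : 0 ≤ M := (norm_nonneg _).trans (hM 0)
  refine ⟨fun t => a t ^ (k + 2), (k + 2) * M, ha.pow _, by positivity,
    fun t => pow_nonneg a.nonneg _, fun t => pow_le_one₀ a.nonneg a.le_one, ?_, ?_, ?_⟩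
  · intro t ht
    have : a t = 1 := a.one_of_mem_closedBall (by
      simpa [a, Real.closedBall_eq_Icc] using ht)
    simp [this]
  · intro t ht
    have : a t = 0 := a.zero_of_le_dist (by
      by_contra h
      rw [not_le, Real.dist_0_eq_abs, abs_lt] at h
      exact ht ⟨h.1.le, h.2.le⟩)
    simp [this]
  · intro t
    have hd : deriv (fun t => a t ^ (k + 2)) t = (k + 2) * a t ^ (k + 1) * deriv a t := by
      have := ((ha.differentiable (by simp) t).hasDerivAt.pow (k + 2)).deriv
      simpa [Pi.pow_def] using this
    rw [hd, abs_mul, abs_of_nonneg (mul_nonneg (by positivity) (pow_nonneg a.nonneg _))]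
    have h1 : a t ^ (k + 1) ≤ (a t ^ (k + 2)) ^ p⁻¹ :=
      (pow_le_pow_of_le_one a.nonneg a.le_one (Nat.le_succ k)).trans
        (pow_le_rpow_inv_pow_add_two hp hk a.nonneg a.le_one)
    calc (k + 2) * a t ^ (k + 1) * |deriv a t| ≤ (k + 2) * (a t ^ (k + 2)) ^ p⁻¹ * M := by
          gcongr
          · exact mul_nonneg (by positivity) (Real.rpow_nonneg (pow_nonneg a.nonneg _) _)
          · exact hM t
      _ = _ := by ring

namespace StratifiedGroup

variable {n m : ℕ} (G : StratifiedGroup n) (b : Module.Basis (Fin m) ℝ G.firstStratum)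

/-- A space cutoff whose sub-Laplacian is controlled by its power `1 / p`: a high power of a bump
function. -/
lemma exists_space_cutoff {p : ℝ} (hp : 1 < p) :
    ∃ (B : (Fin n → ℝ) → ℝ) (K : ℝ), ContDiff ℝ ∞ B ∧ 0 ≤ K ∧ (∀ x, 0 ≤ B x) ∧ (∀ x, B x ≤ 1) ∧
      B 0 = 1 ∧ (∀ x, x ∉ Icc (fun _ => (-2 : ℝ)) (fun _ => 2) → B x = 0) ∧
      (∀ x, |G.subLaplacian b B x| ≤ K * B x ^ p⁻¹) := by
  obtain ⟨k, hk⟩ := exists_nat_add_two_le_mul hp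
  let a : ContDiffBump (0 : Fin n → ℝ) := ⟨1, 2, one_pos, one_lt_two⟩
  have ha : ContDiff ℝ ∞ a := a.contDiff
  have hac : HasCompactSupport a := a.hasCompactSupport
  have hX := fun j => G.contDiff_leftInvariantField (b j : Fin n → ℝ)
  have h1 := fun j => ((hX j).alongField ha)
  have h2 := fun j => ((hX j).alongField (h1 j))
  choose M₁ hM₁ using fun j =>
    (h1 j).continuous.bounded_above_of_compact_support hac.alongField
  choose M₂ hM₂ using fun j =>
    (h2 j).continuous.bounded_above_of_compact_support hac.alongField.alongField
  have hM₁0 : ∀ j, 0 ≤ M₁ j := fun j => (norm_nonneg _).trans (hM₁ j 0)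
  have hM₂0 : ∀ j, 0 ≤ M₂ j := fun j => (norm_nonneg _).trans (hM₂ j 0)
  refine ⟨fun x => a x ^ (k + 2), ∑ j, ((k + 2) * (k + 1) * M₁ j ^ 2 + (k + 2) * M₂ j),
    ha.pow _, Finset.sum_nonneg fun j _ => ?_,
    fun x => pow_nonneg a.nonneg _, fun x => pow_le_one₀ a.nonneg a.le_one, ?_, ?_, ?_⟩
  · have := hM₁0 j
    have := hM₂0 j
    positivity
  · have : a 0 = 1 := a.one_of_mem_closedBall (by simp [a])
    simp [this]
  · intro x hx
    have : a x = 0 := a.zero_of_le_dist (by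
      by_contra h
      rw [not_le, dist_zero_right, pi_norm_lt_iff (by norm_num [a])] at h
      exact hx ⟨fun i => (abs_lt.1 (h i)).1.le, fun i => (abs_lt.1 (h i)).2.le⟩)
    simp [this]
  · intro x
    rw [subLaplacian, Finset.sum_mul]
    refine (Finset.abs_sum_le_sum_abs _ _).trans (Finset.sum_le_sum fun j _ => ?_)
    rw [alongField_alongField_pow (hX j) ha, abs_mul, abs_of_nonneg (pow_nonneg a.nonneg _),
      mul_comm]
    have hb1 := hM₁ j x
    have hb2 := hM₂ j x
    rw [Real.norm_eq_abs] at hb1 hb2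
    have := hM₁0 j
    have := hM₂0 j
    have hsq : alongField (G.leftInvariantField (b j : Fin n → ℝ)) a x ^ 2 ≤ M₁ j ^ 2 :=
      sq_le_sq.2 (hb1.trans (le_abs_self _))
    refine mul_le_mul ?_ (pow_le_rpow_inv_pow_add_two hp hk a.nonneg a.le_one)
      (pow_nonneg a.nonneg _) (by positivity)
    refine (abs_add_le _ _).trans (add_le_add ?_ ?_)
    · rw [abs_of_nonneg (by positivity)]
      gcongr
    · rw [abs_mul, abs_mul, abs_of_nonneg (a.nonneg : 0 ≤ a x),
        abs_of_nonneg (by positivity : (0 : ℝ) ≤ k + 2), mul_assoc]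
      gcongr
      exact (mul_le_mul a.le_one hb2 (abs_nonneg _) zero_le_one).trans (one_mul _).le

end StratifiedGroup

/-! ### Volume and limits under dilations -/

lemma volume_real_Icc_neg_pi {n : ℕ} {r : Fin n → ℝ} (hr : ∀ i, 0 ≤ r i) :
    volume.real (Icc (fun i => -r i) r) = 2 ^ n * ∏ i, r i := by
  rw [measureReal_def, Real.volume_Icc_pi_toReal (fun i => by linarith [hr i])]
  simp_rw [sub_neg_eq_add, ← two_mul]
  simp [Finset.prod_mul_distrib]

namespace DilationGroup

variable {n : ℕ} (G : DilationGroup n)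

/-- The image of the cube `[-2, 2]ⁿ` under the dilation `δ_R`, for `R > 0`. -/
def box (R : ℝ) : Set (Fin n → ℝ) :=
  Icc (fun i => -(2 * R ^ G.weight i)) (fun i => 2 * R ^ G.weight i)

lemma volume_real_box {R : ℝ} (hR : 0 < R) :
    volume.real (G.box R) = 4 ^ n * R ^ G.homDim := by
  rw [box, volume_real_Icc_neg_pi fun i => by positivity, Finset.prod_mul_distrib,
    Finset.prod_pow_eq_pow_sum, homDim]
  rw [Finset.prod_const, Finset.card_univ, Fintype.card_fin, ← _root_.mul_assoc, ← mul_pow]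
  norm_num

lemma dilation_inv_notMem_Icc {R : ℝ} (hR : 0 < R) {x : Fin n → ℝ} (hx : x ∉ G.box R) :
    G.dilation R⁻¹ x ∉ Icc (fun _ => (-2 : ℝ)) (fun _ => 2) := by
  contrapose! hx
  refine ⟨fun i => ?_, fun i => ?_⟩
  · have := hx.1 i
    simp only [dilation_apply, inv_pow] at this
    rw [inv_mul_eq_div, le_div_iff₀ (by positivity)] at this
    simpa using this
  · have := hx.2 i
    simp only [dilation_apply, inv_pow] at this
    rwa [inv_mul_eq_div, div_le_iff₀ (by positivity)] at this

lemma tendsto_dilation_inv (x : Fin n → ℝ) :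
    Tendsto (fun R : ℝ => G.dilation R⁻¹ x) atTop (𝓝 0) := by
  rw [tendsto_pi_nhds]
  intro i
  simp only [dilation_apply]
  have h : Tendsto (fun R : ℝ => R⁻¹ ^ G.weight i * x i) atTop (𝓝 (0 ^ G.weight i * x i)) :=
    (tendsto_inv_atTop_zero.pow _).mul_const _
  simpa [zero_pow (by have := G.one_le_weight i; omega : G.weight i ≠ 0)] using h

end DilationGroup

/-! ### Test functions and the source term -/

/-- A product of smooth compactly supported non-negative functions of time and of space is a test
function. -/
lemma isTestFunction_mul {n : ℕ} {A : ℝ → ℝ} {B : (Fin n → ℝ) → ℝ} (hA : ContDiff ℝ ∞ A)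
    (hB : ContDiff ℝ ∞ B) (hA0 : ∀ t, 0 ≤ A t) (hB0 : ∀ x, 0 ≤ B x)
    (hAs : HasCompactSupport A) (hBs : HasCompactSupport B) :
    IsTestFunction (fun t x => A t * B x) := by
  have hAd : Differentiable ℝ A := hA.differentiable (by simp)
  have hB2 : ContDiff ℝ 2 B := hB.of_le (WithTop.coe_le_coe.2 le_top)
  have hder : ∀ t, (fun x => deriv (fun s => A s * B x) t) = fun x => deriv A t * B x :=
    fun t => funext fun x => deriv_mul_const (hAd t) _
  have hcont : ∀ a : ℝ → ℝ, Continuous a → ∀ j : ℕ, j ≤ 2 → Continuous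
      (fun z : ℝ × (Fin n → ℝ) => iteratedFDeriv ℝ j (fun x => a z.1 * B x) z.2) := by
    intro a ha j hj
    have hBj : ContDiff ℝ j B := hB.of_le (by exact_mod_cast le_top)
    have : ∀ z : ℝ × (Fin n → ℝ), iteratedFDeriv ℝ j (fun x => a z.1 * B x) z.2 =
        a z.1 • iteratedFDeriv ℝ j B z.2 := fun z =>
      iteratedFDeriv_const_smul_apply (a := a z.1) (f := B) hBj.contDiffAt
    simp_rw [this]
    exact (ha.comp continuous_fst).smul
      ((hB.continuous_iteratedFDeriv (by exact_mod_cast le_top)).comp continuous_snd)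
  refine ⟨fun t x _ => mul_nonneg (hA0 t) (hB0 x), ?_, fun t => ?_, hcont A hA.continuous,
    fun x => hAd.mul_const _, fun t => ?_, fun j hj => ?_⟩
  · refine HasCompactSupport.of_support_subset_isCompact (hAs.prod hBs) fun z hz => ?_
    simp only [Function.mem_support, ne_eq, mul_eq_zero, not_or] at hz
    exact ⟨subset_tsupport _ hz.1, subset_tsupport _ hz.2⟩
  · exact contDiff_const.mul hB2
  · rw [hder]
    exact contDiff_const.mul hB2
  · simp_rw [hder]
    exact hcont _ (hA.continuous_deriv (by simp)) j hj

/-- If `∫ f⁻ < ∫ f⁺ ≤ ∞`, the integrals of `f` against cutoffs that tend to `1` are eventually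
bounded below by a positive constant: Fatou's lemma for `f⁺`, and `∫ f⁻ < ∞`. -/
lemma exists_pos_eventually_le_integral_mul {α : Type*} [MeasurableSpace α] {μ : Measure α}
    {f : α → ℝ} {B : ℕ → α → ℝ} (hf : AEMeasurable f μ)
    (hpos : ∫⁻ x, ENNReal.ofReal (-f x) ∂μ < ∫⁻ x, ENNReal.ofReal (f x) ∂μ)
    (hB : ∀ N, Measurable (B N)) (hB0 : ∀ N x, 0 ≤ B N x) (hB1 : ∀ N x, B N x ≤ 1)
    (hlim : ∀ x, Tendsto (fun N => B N x) atTop (𝓝 1))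
    (hint : ∀ N, Integrable (fun x => f x * B N x) μ) :
    ∃ ε > 0, ∀ᶠ N in atTop, ε ≤ ∫ x, f x * B N x ∂μ := by
  obtain ⟨c, hc1, hc2⟩ := exists_between hpos
  have hcfin : c ≠ ⊤ := hc2.ne_top
  have hMfin := hc1.ne_top
  refine ⟨c.toReal - (∫⁻ x, ENNReal.ofReal (-f x) ∂μ).toReal,
    sub_pos.2 ((ENNReal.toReal_lt_toReal hMfin hcfin).2 hc1), ?_⟩
  have hfatou : ∫⁻ x, ENNReal.ofReal (f x) ∂μ ≤
      liminf (fun N => ∫⁻ x, ENNReal.ofReal (f x * B N x) ∂μ) atTop := by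
    refine le_trans (le_of_eq ?_) (lintegral_liminf_le' fun N =>
      (hf.mul (hB N).aemeasurable).ennreal_ofReal)
    refine lintegral_congr fun x => Eq.symm (Tendsto.liminf_eq ?_)
    have := (ENNReal.continuous_ofReal.tendsto _).comp ((hlim x).const_mul (f x))
    simpa [Function.comp_def] using this
  filter_upwards [eventually_lt_of_lt_liminf (hc2.trans_le hfatou)] with N hN
  rw [integral_eq_lintegral_pos_part_sub_lintegral_neg_part (hint N)]
  refine sub_le_sub (ENNReal.toReal_mono ?_ hN.le) (ENNReal.toReal_mono hMfin ?_)
  · exact (hint N).lintegral_lt_top.ne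
  · refine lintegral_mono fun x => ENNReal.ofReal_le_ofReal_iff'.2 ?_
    by_cases h : 0 ≤ f x
    · right
      nlinarith [mul_nonneg h (hB0 N x)]
    · left
      nlinarith [hB1 N x]

/-! ### The test function method -/

/-- The pointwise estimate behind the test function method: Young's inequality absorbs the linear
term `u w` into `|u|^p ψ` as soon as `w` is controlled by `ψ ^ (1 / p)`. -/
lemma neg_rpow_le_rpow_mul_add_mul {p q : ℝ} (hpq : p.HolderConjugate q) {u w ψ c : ℝ}
    (hψ : 0 ≤ ψ) (hc : 0 ≤ c) (hw : |w| ≤ c * ψ ^ p⁻¹) :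
    -c ^ q ≤ |u| ^ p * ψ + u * w := by
  have h1 : |u * w| ≤ (|u| * ψ ^ p⁻¹) * c := by
    rw [abs_mul]
    nlinarith [mul_le_mul_of_nonneg_left hw (abs_nonneg u)]
  have h2 := Real.young_inequality_of_nonneg (mul_nonneg (abs_nonneg u)
    (Real.rpow_nonneg hψ p⁻¹)) hc hpq
  have h3 : (|u| * ψ ^ p⁻¹) ^ p = |u| ^ p * ψ := by
    rw [Real.mul_rpow (abs_nonneg u) (Real.rpow_nonneg hψ _), ← Real.rpow_mul hψ,
      inv_mul_cancel₀ hpq.ne_zero, Real.rpow_one]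
  rw [h3] at h2
  have h4 : |u| ^ p * ψ / p ≤ |u| ^ p * ψ :=
    div_le_self (mul_nonneg (Real.rpow_nonneg (abs_nonneg u) _) hψ) hpq.lt.le
  have h5 : c ^ q / q ≤ c ^ q := div_le_self (Real.rpow_nonneg hc _) hpq.symm.lt.le
  linarith [neg_abs_le (u * w)]

/-- Testing the equation with `ψ`, a product of cutoffs in time and space, and absorbing the terms
linear in `u` leaves a bound for the source term that no longer involves the solution. -/
lemma IsGlobalWeakSolution.integral_mul_integral_le {n m : ℕ} {G : StratifiedGroup n}
    {b : Module.Basis (Fin m) ℝ G.firstStratum} {p q : ℝ} (hpq : p.HolderConjugate q)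
    {u₀ f : (Fin n → ℝ) → ℝ} {u : ℝ → (Fin n → ℝ) → ℝ}
    (h : IsGlobalWeakSolution G b p u₀ f u) (hu₀ : ∀ᵐ x, 0 ≤ u₀ x)
    {A : ℝ → ℝ} {B : (Fin n → ℝ) → ℝ} (hA : ContDiff ℝ ∞ A) (hB : ContDiff ℝ ∞ B)
    (hA0 : ∀ t, 0 ≤ A t) (hB0 : ∀ x, 0 ≤ B x) (hA1 : ∀ t, A t ≤ 1) (hB1 : ∀ x, B x ≤ 1)
    {I : Set ℝ} {J : Set (Fin n → ℝ)} (hI : IsCompact I) (hJ : IsCompact J)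
    (hAI : ∀ t, t ∉ I → A t = 0) (hBJ : ∀ x, x ∉ J → B x = 0) {c₁ c₂ : ℝ}
    (hc₁ : 0 ≤ c₁) (hc₂ : 0 ≤ c₂) (hA' : ∀ t, |deriv A t| ≤ c₁ * A t ^ p⁻¹)
    (hB' : ∀ x, |G.subLaplacian b B x| ≤ c₂ * B x ^ p⁻¹) :
    (∫ t in Ioi 0, A t) * (∫ x, f x * B x) ≤
      (c₁ + c₂) ^ q * (volume.real I * volume.real J) := by
  have hp0 : 0 < p := hpq.pos
  have hq0 : 0 < q := hpq.symm.pos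
  have hAs : HasCompactSupport A := HasCompactSupport.intro hI fun t => hAI t
  have hBs : HasCompactSupport B := HasCompactSupport.intro hJ fun x => hBJ x
  have hψ := isTestFunction_mul hA hB hA0 hB0 hAs hBs
  have hweak := h.weak_form _ hψ
  have i1 := h.integrable_pow _ hψ
  have i2 := h.integrable_time _ hψ
  have i3 := h.integrable_space _ hψ
  have hu0 : 0 ≤ ∫ x, u₀ x * (A 0 * B x) := integral_nonneg_of_ae (by
    filter_upwards [hu₀] with x hx
    exact mul_nonneg hx (mul_nonneg (hA0 0) (hB0 x)))
  have hprod : ∫ z in Ioi (0 : ℝ) ×ˢ (univ : Set (Fin n → ℝ)), f z.2 * (A z.1 * B z.2) =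
      (∫ t in Ioi 0, A t) * (∫ x, f x * B x) := by
    have := setIntegral_prod_mul (μ := (volume : Measure ℝ))
      (ν := (volume : Measure (Fin n → ℝ))) A (fun x => f x * B x) (Ioi 0) univ
    rw [Measure.restrict_univ] at this
    rw [← this, Measure.volume_eq_prod]
    exact integral_congr_ae (ae_of_all _ fun z => by ring)
  have hS : MeasurableSet (I ×ˢ J) := hI.measurableSet.prod hJ.measurableSet
  have hSfin : volume (I ×ˢ J) < ⊤ := (hI.prod hJ).measure_lt_top
  have hSvol : volume.real (I ×ˢ J) = volume.real I * volume.real J := by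
    simp [measureReal_def, Measure.volume_eq_prod, Measure.prod_prod]
  set S := I ×ˢ J
  set μ : Measure (ℝ × (Fin n → ℝ)) := volume.restrict (Ioi (0 : ℝ) ×ˢ univ)
  have i4 : Integrable (S.indicator fun _ => (c₁ + c₂) ^ q) μ :=
    (integrable_indicator_iff hS).2
      (integrableOn_const ((Measure.restrict_apply_le _ _).trans_lt hSfin).ne)
  have hint4 : ∫ z, S.indicator (fun _ => (c₁ + c₂) ^ q) z ∂μ ≤
      (c₁ + c₂) ^ q * (volume.real I * volume.real J) := by
    rw [integral_indicator_const _ hS, smul_eq_mul, mul_comm, ← hSvol]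
    gcongr
    exact ENNReal.toReal_mono hSfin.ne (Measure.restrict_apply_le _ _)
  have hpt : ∀ z : ℝ × (Fin n → ℝ), 0 ≤ |u z.1 z.2| ^ p * (A z.1 * B z.2) +
      u z.1 z.2 * deriv (fun s => A s * B z.2) z.1 +
      u z.1 z.2 * G.subLaplacian b (fun x => A z.1 * B x) z.2 +
      S.indicator (fun _ => (c₁ + c₂) ^ q) z := by
    rintro ⟨t, x⟩
    have hd : deriv (fun s => A s * B x) t = deriv A t * B x :=
      deriv_mul_const (hA.differentiable (by simp) t) _
    simp only [hd, G.subLaplacian_const_mul b hB]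
    have hBr : B x ≤ B x ^ p⁻¹ := Real.self_le_rpow_of_le_one (hB0 x) (hB1 x)
      (inv_le_one_of_one_le₀ hpq.lt.le)
    have hAr : A t ≤ A t ^ p⁻¹ := Real.self_le_rpow_of_le_one (hA0 t) (hA1 t)
      (inv_le_one_of_one_le₀ hpq.lt.le)
    have hB0' := Real.rpow_nonneg (hB0 x) p⁻¹
    have hA0' := Real.rpow_nonneg (hA0 t) p⁻¹
    have hw : |deriv A t * B x + A t * G.subLaplacian b B x| ≤
        (c₁ + c₂) * (A t * B x) ^ p⁻¹ := by
      rw [Real.mul_rpow (hA0 t) (hB0 x)]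
      calc |deriv A t * B x + A t * G.subLaplacian b B x|
          ≤ |deriv A t| * B x + A t * |G.subLaplacian b B x| := by
            refine (abs_add_le _ _).trans_eq ?_
            rw [abs_mul, abs_mul, abs_of_nonneg (hA0 t), abs_of_nonneg (hB0 x)]
        _ ≤ (c₁ * A t ^ p⁻¹) * B x ^ p⁻¹ + A t ^ p⁻¹ * (c₂ * B x ^ p⁻¹) :=
            add_le_add (mul_le_mul (hA' t) hBr (hB0 x) (mul_nonneg hc₁ hA0'))
              (mul_le_mul hAr (hB' x) (abs_nonneg _) hA0')
        _ = _ := by ring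
    by_cases hz : (t, x) ∈ S
    · rw [indicator_of_mem hz]
      have := neg_rpow_le_rpow_mul_add_mul hpq (u := u t x) (mul_nonneg (hA0 t) (hB0 x))
        (add_nonneg hc₁ hc₂) hw
      linarith
    -- Off the supports the bounds on the derivatives force all terms to vanish.
    · have h0 : A t * B x = 0 := by
        by_contra hne
        rw [mul_eq_zero, not_or] at hne
        exact hz ⟨by_contra fun h => hne.1 (hAI t h), by_contra fun h => hne.2 (hBJ x h)⟩
      rw [h0, Real.zero_rpow (inv_ne_zero hp0.ne'), mul_zero] at hw
      have hw0 := abs_nonpos_iff.1 hw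
      rw [indicator_of_notMem hz, h0, mul_zero, zero_add, add_zero, ← mul_add, hw0, mul_zero]
  have hsum := integral_nonneg (μ := μ) (Pi.le_def.2 hpt)
  have e1 := integral_add ((i1.add i2).add i3) i4
  have e2 := integral_add (i1.add i2) i3
  have e3 := integral_add i1 i2
  simp only [Pi.add_apply] at e1 e2 e3
  rw [e1, e2, e3] at hsum
  rw [hprod] at hweak
  linarith

/-- Below the critical exponent there is no weak solution: on the parabolic cylinder of radius `R`
the source contributes at least `ε R²`, the error is of order `R ^ (Q + 2 - 2 q)`, and
`Q < 2 q`. -/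
lemma not_exists_isGlobalWeakSolution_of_homDim_lt {n m : ℕ} (G : StratifiedGroup n)
    (b : Module.Basis (Fin m) ℝ G.firstStratum) {p q : ℝ} (hpq : p.HolderConjugate q)
    (hQ : (G.homDim : ℝ) < 2 * q) {u₀ f : (Fin n → ℝ) → ℝ} (hu₀ : ∀ᵐ x, 0 ≤ u₀ x)
    (hf : LocallyIntegrable f volume)
    (hf_pos : ∫⁻ x, ENNReal.ofReal (-f x) < ∫⁻ x, ENNReal.ofReal (f x)) :
    ¬ ∃ u : ℝ → (Fin n → ℝ) → ℝ, IsGlobalWeakSolution G b p u₀ f u := by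
  rintro ⟨u, hu⟩
  obtain ⟨A, K₁, hA, hK₁, hA0, hA1, hAone, hAsupp, hA'⟩ := exists_time_cutoff hpq.lt
  obtain ⟨B, K₂, hB, hK₂, hB0, hB1, hBone, hBsupp, hB'⟩ := G.exists_space_cutoff b hpq.lt
  have hBR : ∀ R : ℝ, ContDiff ℝ ∞ (fun x => B (G.dilation R⁻¹ x)) := fun R =>
    hB.comp (G.dilation R⁻¹).contDiff
  have hBRsupp : ∀ R : ℝ, 0 < R → ∀ x, x ∉ G.box R → B (G.dilation R⁻¹ x) = 0 :=
    fun R hR x hx => hBsupp _ (G.dilation_inv_notMem_Icc hR hx)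
  let r : ℕ → ℝ := fun N => N + 1
  have hr : ∀ N, 0 < r N := fun N => by positivity
  have hrlim : Tendsto r atTop atTop := tendsto_natCast_atTop_atTop.atTop_add tendsto_const_nhds
  obtain ⟨ε, hε, hev⟩ := exists_pos_eventually_le_integral_mul (μ := volume) (f := f)
    (B := fun N x => B (G.dilation (r N)⁻¹ x)) hf.aestronglyMeasurable.aemeasurable hf_pos
    (fun N => (hBR (r N)).continuous.measurable) (fun N x => hB0 _) (fun N x => hB1 _)
    (fun x => by
      have := (hB.continuous.tendsto 0).comp ((G.tendsto_dilation_inv x).comp hrlim)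
      rwa [hBone] at this)
    (fun N => by
      have := hf.integrable_smul_left_of_hasCompactSupport (hBR (r N)).continuous
        (HasCompactSupport.intro (isCompact_Icc : IsCompact (G.box (r N))) (hBRsupp _ (hr N)))
      simpa [mul_comm] using this)
  -- The time cutoff at scale `R²` equals `1` on `(0, R²]`.
  have htime : ∀ R : ℝ, 0 < R → R ^ 2 ≤ ∫ t in Ioi (0 : ℝ), A ((R ^ 2)⁻¹ * t) := by
    intro R hR
    have hR2 : 0 < R ^ 2 := by positivity
    have hAs : HasCompactSupport A := HasCompactSupport.intro isCompact_Icc hAsupp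
    have hAi : IntegrableOn A (Ioi 0) :=
      (hA.continuous.integrable_of_hasCompactSupport hAs).integrableOn
    rw [integral_comp_mul_left_Ioi _ _ (inv_pos.2 hR2), mul_zero, inv_inv, smul_eq_mul]
    refine le_mul_of_one_le_right hR2.le ?_
    calc (1 : ℝ) = ∫ t in Ioc (0 : ℝ) 1, (1 : ℝ) := by simp
      _ = ∫ t in Ioc (0 : ℝ) 1, A t := setIntegral_congr_fun measurableSet_Ioc fun t ht =>
          (hAone t ⟨by linarith [ht.1], ht.2⟩).symm
      _ ≤ ∫ t in Ioi (0 : ℝ), A t := setIntegral_mono_set hAi (ae_of_all _ hA0)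
          Ioc_subset_Ioi_self.eventuallyLE
  have hkey : ∀ R : ℝ, 0 < R → R ^ 2 * ε ≤ R ^ 2 * ∫ x, f x * B (G.dilation R⁻¹ x) →
      ε ≤ (K₁ + K₂) ^ q * (4 * 4 ^ n) * R ^ ((G.homDim : ℝ) - 2 * q) := by
    intro R hR hεR
    have hR2 : 0 < R ^ 2 := by positivity
    have hbound := hu.integral_mul_integral_le hpq hu₀ (A := fun t => A ((R ^ 2)⁻¹ * t))
      (B := fun x => B (G.dilation R⁻¹ x)) (J := G.box R)
      (hA.comp (contDiff_const.mul contDiff_id)) (hBR R)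
      (fun t => hA0 _) (fun x => hB0 _) (fun t => hA1 _) (fun x => hB1 _)
      (isCompact_Icc : IsCompact (Icc (-(2 * R ^ 2)) (2 * R ^ 2)))
      (isCompact_Icc : IsCompact (G.box R))
      (fun t ht => hAsupp _ (by
        contrapose! ht
        rw [mem_Icc, inv_mul_eq_div, le_div_iff₀ hR2, div_le_iff₀ hR2] at ht
        exact ⟨by linarith [ht.1], ht.2⟩))
      (hBRsupp R hR) (c₁ := (R ^ 2)⁻¹ * K₁) (c₂ := (R ^ 2)⁻¹ * K₂) (by positivity)
      (by positivity)
      (fun t => by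
        rw [deriv_comp_mul_left, smul_eq_mul, abs_mul, abs_of_pos (inv_pos.2 hR2), mul_assoc]
        exact mul_le_mul_of_nonneg_left (hA' _) (inv_pos.2 hR2).le)
      (fun x => by
        rw [G.subLaplacian_comp_dilation b (inv_pos.2 hR) hB, inv_pow, abs_mul,
          abs_of_pos (inv_pos.2 hR2), mul_assoc]
        exact mul_le_mul_of_nonneg_left (hB' _) (inv_pos.2 hR2).le)
    have hI : volume.real (Icc (-(2 * R ^ 2)) (2 * R ^ 2)) = 4 * R ^ 2 := by
      rw [Real.volume_real_Icc_of_le (by linarith)]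
      ring
    rw [G.volume_real_box hR, hI, ← mul_add,
      Real.mul_rpow (inv_pos.2 hR2).le (add_nonneg hK₁ hK₂)] at hbound
    have hfpos : 0 ≤ ∫ x, f x * B (G.dilation R⁻¹ x) :=
      hε.le.trans (le_of_mul_le_mul_left hεR hR2)
    have hscale : R ^ ((G.homDim : ℝ) - 2 * q) = ((R ^ 2)⁻¹) ^ q * R ^ G.homDim := by
      rw [Real.inv_rpow hR2.le, ← Real.rpow_natCast R 2, ← Real.rpow_mul hR.le,
        Real.rpow_sub hR, Real.rpow_natCast]
      push_cast
      rw [div_eq_inv_mul]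
    rw [hscale]
    refine le_of_mul_le_mul_left ?_ hR2
    calc R ^ 2 * ε ≤ R ^ 2 * ∫ x, f x * B (G.dilation R⁻¹ x) := hεR
      _ ≤ (∫ t in Ioi (0 : ℝ), A ((R ^ 2)⁻¹ * t)) * ∫ x, f x * B (G.dilation R⁻¹ x) :=
          mul_le_mul_of_nonneg_right (htime R hR) hfpos
      _ ≤ _ := hbound
      _ = _ := by ring
  have hlim : Tendsto (fun N => (K₁ + K₂) ^ q * (4 * 4 ^ n) * r N ^ ((G.homDim : ℝ) - 2 * q))
      atTop (𝓝 0) := by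
    have := ((tendsto_rpow_neg_atTop (sub_pos.2 hQ)).comp hrlim).const_mul
      ((K₁ + K₂) ^ q * (4 * 4 ^ n))
    simpa [Function.comp_def] using this
  refine hε.not_ge (ge_of_tendsto hlim ?_)
  filter_upwards [hev] with N hN
  exact hkey (r N) (hr N) (mul_le_mul_of_nonneg_left hN (by positivity))

theorem mainTheorem1 {n m : ℕ} (G : StratifiedGroup n)
    (b : Module.Basis (Fin m) ℝ G.firstStratum) (p : ℝ) (hp : 1 < p)
    (u₀ f : (Fin n → ℝ) → ℝ)
    (hu₀ : LocallyIntegrable u₀ volume) (hu₀_nonneg : ∀ᵐ x, 0 ≤ u₀ x)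
    (hf : LocallyIntegrable f volume)
    (hf_pos : ∫⁻ x, ENNReal.ofReal (-f x) < ∫⁻ x, ENNReal.ofReal (f x)) :
    (3 ≤ G.homDim → p < (G.homDim : ℝ) / ((G.homDim : ℝ) - 2) →
      ¬ ∃ u : ℝ → (Fin n → ℝ) → ℝ, IsGlobalWeakSolution G b p u₀ f u) ∧
    (G.homDim = 1 ∨ G.homDim = 2 →
      ¬ ∃ u : ℝ → (Fin n → ℝ) → ℝ, IsGlobalWeakSolution G b p u₀ f u) := by
  have hpq := Real.HolderConjugate.conjExponent hp
  refine ⟨fun hQ hpQ => not_exists_isGlobalWeakSolution_of_homDim_lt G b hpq ?_ hu₀_nonneg hf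
    hf_pos, fun hQ => not_exists_isGlobalWeakSolution_of_homDim_lt G b hpq ?_ hu₀_nonneg hf
    hf_pos⟩
  -- Both cases say that `Q < 2 q` with `q = p / (p - 1)`.
  · have hQ' : (3 : ℝ) ≤ G.homDim := by exact_mod_cast hQ
    rw [lt_div_iff₀ (by linarith)] at hpQ
    rw [Real.conjExponent, mul_div_assoc', lt_div_iff₀ (by linarith)]
    linarith
  · have hQ' : (G.homDim : ℝ) ≤ 2 := by
      rcases hQ with h | h <;> norm_num [h]
    linarith [hpq.symm.lt]
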